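/- Assume Ostaszewski's principle $\clubsuit$: writing $\mathcal L(\omega_1)$ for the set of nonzero countable limit ordinals, there are sets $F_\alpha\subset\alpha$ with $\sup F_\alpha=\alpha$ $(\alpha\in\mathcal L(\omega_1))$ such that every uncountable $A\subset\omega_1$ contains $F_\alpha$ for some $\alpha\in\mathcal L(\omega_1)$. Then there is a locally compact Hausdorff space $L$ with the following three properties. (1) There is a continuous surjection $\varphi:L\to\omega_1$ (with $\omega_1$ carrying the order topology) such that $\varphi^{-1}[\{\alpha\}]$ is finite for every $\alpha<\omega_1$; that is, $L$ belongs to the class $\mathcal S$. (2) $L$ has height $\omega$: the least ordinal $\rho$ for which the Cantor–Bendixson derivative $L^{(\rho)}$ is empty is $\rho=\omega$. (3) $L$ has the collapsing property. Namely, let $K=L\cup\{\infty\}$ be the one-point compactification of $L$, let $m\ge 1$, let $\{I_1,\dots,I_k\}$ be a partition of $\{1,\dots,m\}$ into nonempty blocks, and let $C\subset L^m$ be uncountable. For $x=(x_1,\dots,x_m)\in C$ put $G_j^x=\{x_i:i\in I_j\}$, and suppose that $C$ is $(I_1,\dots,I_k)$-separated: for each $j$ the cardinality of $G_j^x$ is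 the same for all $x\in C$, and $G_i^x\cap G_j^y=\emptyset$ for all $x,y\in C$ and $1\le i,j\le k$ with $i\ne j$ or $x\ne y$. Then $C$ has an accumulation point $(q_1,\dots,q_m)\in K^m$ (product topology) such that, for some pairwise distinct $a_1,\dots,a_k\in K$ with $a_k=\infty$, we have $\{q_i:i\in I_j\}=\{a_j\}$ for every $1\le j\le k$. -/

import Mathlib

universe u

open Set Topology Filter
open scoped Ordinal CantorBendixson OnePoint

/-- Ostaszewski's `♣` principle: there are cofinal sets `F α ⊆ α`, for `α` a (nonzero) countable
limit ordinal, such that every uncountable subset of `ω₁` contains some `F α`. -/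
def Clubsuit : Prop :=
  ∃ F : Ordinal.{u} → Set Ordinal.{u},
    (∀ α < ω₁, Order.IsSuccLimit α → F α ⊆ Iio α ∧ IsLUB (F α) α) ∧
    ∀ A : Set Ordinal.{u}, A ⊆ Iio ω₁ → ¬ A.Countable →
      ∃ α < ω₁, Order.IsSuccLimit α ∧ F α ⊆ A

/-- The class `𝒮`: locally compact spaces with a finite-to-one continuous surjection onto
`ω₁ = {α | α < ω₁}`, which carries its order topology. -/
def InClassS (L : Type u) [TopologicalSpace L] : Prop :=
  LocallyCompactSpace L ∧
    ∃ φ : L → Iio (ω₁ : Ordinal.{u}), Continuous φ ∧ Function.Surjective φ ∧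
      ∀ α, (φ ⁻¹' {α}).Finite

/-- `ρ` is the least ordinal whose Cantor-Bendixson derivative `L^(ρ)` is empty. -/
def HasHeight (L : Type u) [TopologicalSpace L] (ρ : Ordinal.{u}) : Prop :=
  IsLeast {σ : Ordinal.{u} | (univ : Set L)ᵈ[σ] = ∅} ρ

/-- `(I 0, …, I (k-1))` is an (ordered) partition of `{0, …, m-1}` into `k` blocks. -/
structure IsOrderedPartition {m k : ℕ} (I : Fin k → Set (Fin m)) : Prop where
  nonempty : ∀ j, (I j).Nonempty
  disjoint : ∀ i j, i ≠ j → Disjoint (I i) (I j)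
  cover : ⋃ j, I j = univ

/-- A family of `k`-tuples of subsets of `L` is `k`-separated: the `j`-th entries all have the same
nonzero finite cardinality `c j`, and any two entries are disjoint unless they
have the same index and the same position. -/
def IsKSeparated {L : Type*} {k : ℕ} {Γ : Type*} (G : Γ → Fin k → Set L) : Prop :=
  (∃ c : Fin k → ℕ, (∀ j, c j ≠ 0) ∧ ∀ l j, (G l j).ncard = c j) ∧
    ∀ (l l' : Γ) (i j : Fin k), (i ≠ j ∨ l ≠ l') → Disjoint (G l i) (G l' j)

/-- A subset `C` of `L^m` is `(I 0, …, I (k-1))`-separated: the tuples of sets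
`({x i | i ∈ I 0}, …, {x i | i ∈ I (k-1)})`, for `x ∈ C`, form a `k`-separated family. -/
def IsPartitionSeparated {L : Type*} {m k : ℕ} (I : Fin k → Set (Fin m))
    (C : Set (Fin m → L)) : Prop :=
  IsKSeparated fun (x : C) (j : Fin k) => x.1 '' I j

/-- `C ⊆ L^m` collapses: it has an accumulation point `q ∈ K^m`, where `K = L ∪ {∞}`, for which
there are distinct `a 0, …, a k ∈ K` with `a k = ∞` (the last one) and
`{q i | i ∈ I j} = {a j}` for every `j`. -/
def Collapses {L : Type*} [TopologicalSpace L] {m k : ℕ} (I : Fin (k + 1) → Set (Fin m))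
    (C : Set (Fin m → L)) : Prop :=
  ∃ q : Fin m → OnePoint L,
    AccPt q (𝓟 ((fun (x : Fin m → L) (i : Fin m) => (x i : OnePoint L)) '' C)) ∧
    ∃ a : Fin (k + 1) → OnePoint L, Function.Injective a ∧ a (Fin.last k) = ∞ ∧
      ∀ j, q '' I j = {a j}

/-- The collapsing property. (A partition of a nonempty finite set has at least one block,
so the number of blocks is written `k + 1`.) -/
def HasCollapsingProperty (L : Type*) [TopologicalSpace L] : Prop :=
  ∀ (m k : ℕ) (I : Fin (k + 1) → Set (Fin m)), 1 ≤ m → IsOrderedPartition I →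
    ∀ C : Set (Fin m → L), ¬ C.Countable → IsPartitionSeparated I C → Collapses I C

/-!
The points of `L` are pairs (level, index) with levels in `ω₁` and finitely many indices at each
level. The topology is determined level by level. A guess is a finite set of points labelled by
natural numbers, and at level `δ` there is a sequence of guesses whose levels climb to `δ`. The point
of level `δ` and index `i` has the neighbourhoods that consist of the point itself and of small
neighbourhoods of the `i`-labelled points in a tail of that sequence; labels without a
corresponding point of level `δ` are left to escape to infinity. How small these neighbourhoods have to
be depends only on the ladders along which the sequences climb, not on the topology, so that
neighbourhoods can be described by the inductive predicate `LadderSystem.Near` instead of a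
transfinite construction. Neighbourhoods of different points of a level are disjoint
(`LadderSystem.Near.eq_of_level_eq`); this makes the space Hausdorff, makes basic neighbourhoods
compact (`LadderSystem.isCompact_near`) and lets the remaining labelled points leave every compact
set (`LadderSystem.tendsto_cocompact_of_mem_stage`).

The guesses come from `♣`, by coding guesses as elements of `ω₁` and thinning out uncountable families
such that codes and levels interleave (`exists_guessing`). Given a separated family of tuples, label
the entries of block `j` by `j + 1`. A sequence of such tuples is guessed at some level `α`, where
all blocks but the last have a point to converge to (`LadderSystem.exists_converging_sequence`).
This is the collapsing property. Applied to single points, it shows that derived sets of uncountable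
sets are uncountable, so derivatives of finite order are nonempty. On the other hand each guess
carries a bound for nominal ranks in `ℕ`; only guesses below the nominal rank of their level are used,
and this bounds the Cantor-Bendixson rank of each point by its nominal rank.
-/

/-! ### Guessing sequences from `♣` -/

/-- An uncountable set can be thinned out to an uncountable set that is pairwise related by a
symmetric relation, if every element is related to all but countably many others. -/
theorem exists_uncountable_pairwise {T : Type*} {A : Set T} (hA : ¬ A.Countable)
    {r : T → T → Prop} (hsymm : ∀ a b, r a b → r b a)
    (hr : ∀ a ∈ A, {b ∈ A | ¬ r a b}.Countable) :
    ∃ B ⊆ A, ¬ B.Countable ∧ B.Pairwise r := by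
  obtain ⟨B, hB⟩ := zorn_subset {B : Set T | B ⊆ A ∧ B.Pairwise r} (by
    intro c hc hchain
    refine ⟨⋃₀ c, ⟨sUnion_subset fun s hs => (hc hs).1, ?_⟩, fun s hs => subset_sUnion_of_mem hs⟩
    exact (pairwise_sUnion hchain.directedOn).2 fun s hs => (hc hs).2)
  refine ⟨B, hB.prop.1, fun hcount => hA ?_, hB.prop.2⟩
  have hcov : (⋃ a ∈ B, ({b ∈ A | ¬ r a b} ∪ {a})).Countable :=
    hcount.biUnion fun a ha => (hr a (hB.prop.1 ha)).union (countable_singleton a)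
  refine hcov.mono fun b hb => ?_
  by_contra hnot
  simp only [mem_iUnion, mem_union, mem_ofPred_eq, mem_singleton_iff, not_exists, not_or, not_and,
    not_not] at hnot
  have hmem : b ∈ B := by
    refine hB.le_of_ge (y := insert b B) ⟨insert_subset hb hB.prop.1, ?_⟩ (subset_insert b B)
      (mem_insert b B)
    refine hB.prop.2.insert fun a ha _ => ?_
    have := (hnot a ha).1 hb
    exact ⟨hsymm _ _ this, this⟩
  exact (hnot b hmem).2 rfl

/-- A countable initial segment without maximum has a strictly increasing cofinal sequence inside
any given cofinal subset. -/
theorem exists_strictMono_cofinal {W : Type*} [LinearOrder W] {α : W} (hα : (Iio α).Countable)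
    {S : Set W} (hS : S ⊆ Iio α) (hne : ∃ x, x < α) (hcof : ∀ γ < α, ∃ x ∈ S, γ < x) :
    ∃ x : ℕ → W, StrictMono x ∧ (∀ n, x n ∈ S) ∧ ∀ γ < α, ∃ n, γ < x n := by
  have : Countable S := (hα.mono hS).to_subtype
  have : Nonempty S := by
    obtain ⟨γ, hγ⟩ := hne
    obtain ⟨x, hx, -⟩ := hcof γ hγ
    exact ⟨⟨x, hx⟩⟩
  have : NoMaxOrder S := ⟨fun a => by
    obtain ⟨x, hx, hlt⟩ := hcof a (hS a.2)
    exact ⟨⟨x, hx⟩, hlt⟩⟩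
  obtain ⟨u, hu⟩ := exists_seq_tendsto (atTop : Filter S)
  obtain ⟨φ, hφ, hmono⟩ := strictMono_subseq_of_tendsto_atTop hu
  refine ⟨fun n => (u (φ n) : W), fun a b hab => hmono hab, fun n => (u (φ n)).2, fun γ hγ => ?_⟩
  obtain ⟨x, hx, hlt⟩ := hcof γ hγ
  obtain ⟨n, hn⟩ := ((hu.comp hφ.tendsto_atTop).eventually_ge_atTop ⟨x, hx⟩).exists
  exact ⟨n, hlt.trans_le hn⟩

/-- `♣` transferred to a well-order `W` of type `ω₁`, with the cofinal sets chosen as strictly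
increasing sequences. -/
theorem Clubsuit.exists_sequences (hclub : Clubsuit.{u})
    (hW : ∀ γ : (ω₁ : Ordinal.{u}).ToType, (Iio γ).Countable) :
    ∃ x : (ω₁ : Ordinal.{u}).ToType → ℕ → (ω₁ : Ordinal.{u}).ToType,
      ∀ A : Set (ω₁ : Ordinal.{u}).ToType, ¬ A.Countable → ∃ α,
        (∀ n, x α n ∈ A) ∧ StrictMono (x α) ∧ (∀ n, x α n < α) ∧ ∀ γ < α, ∃ n, γ < x α n := by
  obtain ⟨F, hF, hguess⟩ := hclub
  let f := Ordinal.ToType.mk (o := (ω₁ : Ordinal.{u}))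
  let ι : (ω₁ : Ordinal.{u}).ToType → Ordinal.{u} := fun w => (f.symm w : Ordinal.{u})
  have hιinj : Function.Injective ι := Subtype.val_injective.comp f.symm.injective
  have hιlt : ∀ {a b}, ι a < ι b ↔ a < b := fun {a b} => f.symm.lt_iff_lt
  have hex : ∀ α, Order.IsSuccLimit (ι α) → ∃ x : ℕ → (ω₁ : Ordinal.{u}).ToType,
      StrictMono x ∧ (∀ n, x n ∈ ι ⁻¹' F (ι α)) ∧ (∀ n, x n < α) ∧ ∀ γ < α, ∃ n, γ < x n := by
    intro α hα
    obtain ⟨hsub, hlub⟩ := hF (ι α) (f.symm α).2 hα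
    have hcof : ∀ γ < α, ∃ x ∈ ι ⁻¹' F (ι α), γ < x := by
      intro γ hγ
      obtain ⟨c, hc, hlt, -⟩ := hlub.exists_between (hιlt.2 hγ)
      have hcω : c < ω₁ := (mem_Iio.1 (hsub hc)).trans (f.symm α).2
      have hιc : ι (f ⟨c, hcω⟩) = c := by simp [ι]
      exact ⟨f ⟨c, hcω⟩, by rwa [mem_preimage, hιc], by rwa [← hιlt, hιc]⟩
    have hne : ∃ x, x < α := by
      obtain ⟨c, hc⟩ := not_isMin_iff.1 hα.1
      have hcω : c < ω₁ := hc.trans (f.symm α).2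
      exact ⟨f ⟨c, hcω⟩, by rw [← hιlt]; simpa [ι] using hc⟩
    have hsub' : ι ⁻¹' F (ι α) ⊆ Iio α := fun x hx => hιlt.1 (hsub hx)
    obtain ⟨x, hx, hmem, hx'⟩ := exists_strictMono_cofinal (hW α) hsub' hne hcof
    exact ⟨x, hx, hmem, fun n => hsub' (hmem n), hx'⟩
  have : Nonempty (ω₁ : Ordinal.{u}).ToType := ⟨f ⟨0, Ordinal.omega_pos 1⟩⟩
  choose! x hx using hex
  refine ⟨x, fun A hA => ?_⟩
  have hAι : ¬ (ι '' A).Countable := fun h => hA <| by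
    simpa [preimage_image_eq _ hιinj] using h.preimage hιinj
  obtain ⟨β, hβ, hlim, hsub⟩ := hguess (ι '' A) (by rintro _ ⟨a, -, rfl⟩; exact (f.symm a).2) hAι
  have hιβ : ι (f ⟨β, hβ⟩) = β := by simp [ι]
  obtain ⟨h1, h2, h3, h4⟩ := hx (f ⟨β, hβ⟩) (by rwa [hιβ])
  refine ⟨f ⟨β, hβ⟩, fun n => ?_, h1, h3, h4⟩
  obtain ⟨a, ha, hax⟩ := hsub (hιβ ▸ h2 n)
  rwa [← hιinj hax]

/-- Guessing sequences of arbitrary objects `t : T`, each of which occupies a countable set `lv t`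
of levels. Every uncountable family of which only countably many members reach below any given
level contains one of the guessed sequences `s α`, and the levels of its terms are separated
by a ladder `b α` that climbs to `α`. -/
theorem exists_guessing {W T : Type*} [LinearOrder W] [Nonempty T]
    (hW : ∀ γ : W, (Iic γ).Countable) {x : W → ℕ → W}
    (hx : ∀ A : Set W, ¬ A.Countable → ∃ α,
      (∀ n, x α n ∈ A) ∧ StrictMono (x α) ∧ (∀ n, x α n < α) ∧ ∀ γ < α, ∃ n, γ < x α n)
    {e : T → W} (he : Function.Injective e) (lv : T → Set W) (hlv : ∀ t, (lv t).Countable) :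
    ∃ (s : W → ℕ → T) (b : W → ℕ → W), ∀ A : Set T, ¬ A.Countable →
      (∀ γ, {t ∈ A | ∃ y ∈ lv t, y ≤ γ}.Countable) → ∃ α,
        StrictMono (b α) ∧ (∀ n, b α n < α) ∧ (∀ γ < α, ∃ n, γ < b α n) ∧
        ∀ n, s α n ∈ A ∧ ∀ y ∈ lv (s α n), b α n < y ∧ y < b α (n + 1) := by
  -- Odd terms of the guessed sequence code the objects, even terms form the ladder.
  refine ⟨fun α n => Function.invFun e (x α (2 * n + 1)), fun α n => x α (2 * n),
    fun A hA hthin => ?_⟩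
  have hle : ∀ γ, {t | e t ≤ γ}.Countable := fun γ => (hW γ).preimage he
  let r₀ : T → T → Prop := fun a c => e a < e c → (∀ y ∈ lv c, e a < y) ∧ ∀ y ∈ lv a, y < e c
  obtain ⟨B, hBA, hB, hpw⟩ := exists_uncountable_pairwise (r := fun a c => r₀ a c ∧ r₀ c a) hA
    (fun a c h => ⟨h.2, h.1⟩) (by
      intro a ha
      refine (((hthin (e a)).union ((hlv a).biUnion fun y _ => hle y)).union (hle (e a))).mono ?_
      rintro c ⟨hc, hn⟩
      by_contra hcon
      simp only [mem_union, mem_ofPred_eq, mem_iUnion, not_or, not_exists, not_and, not_le,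
        exists_prop] at hcon
      exact hn ⟨fun _ => ⟨fun y hy => hcon.1.1 hc y hy, fun y hy => hcon.1.2 y hy⟩,
        fun h => absurd h hcon.2.le.not_gt⟩)
  have heB : ¬ (e '' B).Countable := fun h => hB <| by
    simpa [preimage_image_eq _ he] using h.preimage he
  obtain ⟨α, hmem, hmono, hlt, hcof⟩ := hx _ heB
  have hinv : ∀ n, Function.invFun e (x α n) ∈ B ∧ e (Function.invFun e (x α n)) = x α n := by
    intro n
    obtain ⟨t, ht, hte⟩ := hmem n
    rw [← hte, Function.leftInverse_invFun he t]
    exact ⟨ht, rfl⟩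
  have hsep : ∀ {i j}, i < j → (∀ y ∈ lv (Function.invFun e (x α j)), x α i < y) ∧
      ∀ y ∈ lv (Function.invFun e (x α i)), y < x α j := by
    intro i j hij
    have hlt' := hmono hij
    have hne : Function.invFun e (x α i) ≠ Function.invFun e (x α j) := fun h => by
      have := congrArg e h
      rw [(hinv i).2, (hinv j).2] at this
      exact hlt'.ne this
    have := (hpw (hinv i).1 (hinv j).1 hne).1
    simp only [r₀, (hinv i).2, (hinv j).2] at this
    exact this hlt'
  refine ⟨α, fun i j hij => hmono (by omega), fun n => hlt _, fun γ hγ => ?_, fun n =>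
    ⟨hBA (hinv _).1, fun y hy => ⟨(hsep (by omega)).1 y hy, (hsep (by omega)).2 y hy⟩⟩⟩
  obtain ⟨n, hn⟩ := hcof γ hγ
  exact ⟨n, hn.trans_le (hmono.monotone (by omega))⟩

/-! ### Spaces built from ladders -/

/-- The combinatorial data of a space finite-to-one over a well-order `W`. A point is determined by
its level and its index. Stage `n` at level `δ` is a finite set of labelled points of level
below `δ`; the labelled point `(q, i)` is meant to approach the point of level `δ` and index `i` as
`n` grows, and to approach infinity when there is no such point. The levels in stage `n` lie between
two rungs of a ladder leading to `δ`; a level where all stages are empty consists of isolated points,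
and there the ladder may be constant. -/
structure LadderSystem (W : Type u) [LinearOrder W] where
  Point : Type u
  level : Point → W
  index : Point → ℕ
  ext_point : ∀ {p q}, level p = level q → index p = index q → p = q
  stage : W → ℕ → Set (Point × ℕ)
  ladder : W → ℕ → W
  stage_finite : ∀ δ n, (stage δ n).Finite
  label_unique : ∀ {δ n q i j}, (q, i) ∈ stage δ n → (q, j) ∈ stage δ n → i = j
  ladder_mono : ∀ δ, Monotone (ladder δ)
  ladder_lt : ∀ {δ n q i}, (q, i) ∈ stage δ n → ladder δ n < level q
  le_ladder : ∀ {δ n q i}, (q, i) ∈ stage δ n → level q ≤ ladder δ (n + 1)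
  level_lt : ∀ {δ n q i}, (q, i) ∈ stage δ n → level q < δ
  ladder_cofinal : ∀ {δ γ}, γ < δ → ∃ n, γ ≤ ladder δ n

namespace LadderSystem

variable {W : Type u} [LinearOrder W] (S : LadderSystem W)

theorem eventually_le_ladder {δ γ : W} (h : γ < δ) : ∀ᶠ n in atTop, γ ≤ S.ladder δ n := by
  obtain ⟨n, hn⟩ := S.ladder_cofinal h
  exact eventually_atTop.2 ⟨n, fun m hm => hn.trans (S.ladder_mono δ hm)⟩

/-- Finitely many points of different levels below `δ` get separated by going far enough along their
ladders. -/
theorem exists_height (δ : W) (n : ℕ) : ∃ h : ℕ, ∀ z ∈ S.stage δ n,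
    S.ladder δ n ≤ S.ladder (S.level z.1) h ∧ ∀ z' ∈ S.stage δ n, S.level z'.1 < S.level z.1 →
      S.level z'.1 ≤ S.ladder (S.level z.1) h := by
  have hfin := S.stage_finite δ n
  refine Eventually.exists (f := atTop) ?_
  refine hfin.eventually_all.2 fun z hz => ?_
  refine (S.eventually_le_ladder (S.ladder_lt hz)).and (hfin.eventually_all.2 fun z' _ => ?_)
  by_cases h : S.level z'.1 < S.level z.1
  · exact (S.eventually_le_ladder h).mono fun _ hm _ => hm
  · exact .of_forall fun _ h' => absurd h' h

/-- The size of the neighbourhoods used for the points of stage `n` at level `δ`. -/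
noncomputable def height (δ : W) (n : ℕ) : ℕ := (S.exists_height δ n).choose

theorem ladder_le_ladder_height {δ n q i} (hq : (q, i) ∈ S.stage δ n) :
    S.ladder δ n ≤ S.ladder (S.level q) (S.height δ n) :=
  ((S.exists_height δ n).choose_spec _ hq).1

theorem level_le_ladder_height {δ n q i q' i'} (hq : (q, i) ∈ S.stage δ n)
    (hq' : (q', i') ∈ S.stage δ n) (hlt : S.level q < S.level q') :
    S.level q ≤ S.ladder (S.level q') (S.height δ n) :=
  ((S.exists_height δ n).choose_spec _ hq').2 _ hq hlt

/-- `S.Near p m r` says that `r` belongs to the `m`-th basic neighbourhood of `p`. This consists of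
`p` itself and, for all `n ≥ m`, of basic neighbourhoods of the finitely many points in stage `n`
that are labelled by `p`. -/
inductive Near : S.Point → ℕ → S.Point → Prop
  | refl (p m) : Near p m p
  | step {p m n q r} (hn : m ≤ n) (hq : (q, S.index p) ∈ S.stage (S.level p) n)
      (hr : Near q (S.height (S.level p) n) r) : Near p m r

variable {S}

theorem Near.mono {p r : S.Point} {m m' : ℕ} (h : S.Near p m r) (hm : m' ≤ m) : S.Near p m' r := by
  cases h with
  | refl => exact .refl _ _
  | step hn hq hr => exact .step (hm.trans hn) hq hr

theorem Near.level_bounds {p r : S.Point} {m : ℕ} (h : S.Near p m r) :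
    r = p ∨ (S.ladder (S.level p) m < S.level r ∧ S.level r < S.level p) := by
  induction h with
  | refl => exact .inl rfl
  | @step p m n q r hn hq _ ih =>
    have hm := S.ladder_mono (S.level p) hn
    refine .inr ?_
    rcases ih with rfl | ⟨h1, h2⟩
    · exact ⟨hm.trans_lt (S.ladder_lt hq), S.level_lt hq⟩
    · exact ⟨(hm.trans (S.ladder_le_ladder_height hq)).trans_lt h1, h2.trans (S.level_lt hq)⟩

theorem Near.level_le {p r : S.Point} {m : ℕ} (h : S.Near p m r) : S.level r ≤ S.level p := by
  rcases h.level_bounds with rfl | h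
  exacts [le_rfl, h.2.le]

theorem Near.exists_subset {p q : S.Point} {m : ℕ} (h : S.Near p m q) :
    ∃ m', ∀ r, S.Near q m' r → S.Near p m r := by
  induction h with
  | refl p m => exact ⟨m, fun _ => id⟩
  | step hn hq _ ih =>
    obtain ⟨m', hm'⟩ := ih
    exact ⟨m', fun r hr => .step hn hq (hm' r hr)⟩

theorem not_near_of_level_lt {q q' r : S.Point} {m m' : ℕ} (hlt : S.level q < S.level q')
    (hle : S.level q ≤ S.ladder (S.level q') m') (h : S.Near q m r) : ¬ S.Near q' m' r := by
  intro h'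
  rcases h'.level_bounds with rfl | ⟨h1, -⟩
  · exact h.level_le.not_gt hlt
  · exact (h.level_le.trans hle).not_gt h1

theorem ladder_lt_of_near_height {δ n q i r} (hq : (q, i) ∈ S.stage δ n)
    (h : S.Near q (S.height δ n) r) : S.ladder δ n < S.level r := by
  rcases h.level_bounds with rfl | ⟨h1, -⟩
  exacts [S.ladder_lt hq, (S.ladder_le_ladder_height hq).trans_lt h1]

/-- The neighbourhoods used in different stages at the same level lie between different rungs. -/
theorem stage_eq_of_near {δ n n' q i q' i' r} (hq : (q, i) ∈ S.stage δ n)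
    (hq' : (q', i') ∈ S.stage δ n') (h : S.Near q (S.height δ n) r)
    (h' : S.Near q' (S.height δ n') r) : n = n' := by
  have key : ∀ {n n' q i q' i'}, (q, i) ∈ S.stage δ n → (q', i') ∈ S.stage δ n' →
      S.Near q (S.height δ n) r → S.Near q' (S.height δ n') r → ¬ n < n' := by
    intro n n' q i q' i' hq hq' h h' hlt
    have h1 := h.level_le.trans ((S.le_ladder hq).trans (S.ladder_mono δ (Nat.succ_le_of_lt hlt)))
    exact h1.not_gt (ladder_lt_of_near_height hq' h')
  have := key hq hq' h h'
  have := key hq' hq h' h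
  omega

/-- Different points of the same level have disjoint basic neighbourhoods. -/
theorem Near.eq_of_level_eq {p p' r : S.Point} {m m' : ℕ} (h : S.Near p m r)
    (h' : S.Near p' m' r) (hl : S.level p = S.level p') : p = p' := by
  induction h generalizing p' m' with
  | refl p m =>
    rcases h'.level_bounds with h | ⟨-, h⟩
    exacts [h, absurd hl h.ne]
  | @step p m n q r hn hq hr ih =>
    cases h' with
    | refl =>
      rcases (Near.step hn hq hr).level_bounds with h | ⟨-, h⟩
      exacts [h.symm, absurd hl h.ne']
    | @step _ _ n' q' _ hn' hq' hr' =>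
      rw [← hl] at hq' hr'
      obtain rfl := stage_eq_of_near hq hq' hr hr'
      refine S.ext_point hl ?_
      rcases lt_trichotomy (S.level q) (S.level q') with hlt | heq | hlt
      · exact absurd hr' (not_near_of_level_lt hlt (S.level_le_ladder_height hq hq' hlt) hr)
      · obtain rfl := ih hr' heq
        exact S.label_unique hq hq'
      · exact absurd hr (not_near_of_level_lt hlt (S.level_le_ladder_height hq' hq hlt) hr')

/-- A point of a stage is not near the points of that level other than the one in its label. -/
theorem not_near_of_index_ne {δ n q i} {p : S.Point} (hq : (q, i) ∈ S.stage δ n)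
    (hp : S.level p = δ) (hne : S.index p ≠ i) {m : ℕ} : ¬ S.Near p m q := by
  subst hp
  intro h
  cases h with
  | refl => exact (S.level_lt hq).ne rfl
  | @step _ _ n' q' _ hn' hq' hr' =>
    have hr := Near.refl q (S.height (S.level p) n)
    obtain rfl := stage_eq_of_near hq hq' hr hr'
    rcases lt_trichotomy (S.level q) (S.level q') with hlt | heq | hlt
    · exact not_near_of_level_lt hlt (S.level_le_ladder_height hq hq' hlt) hr hr'
    · obtain rfl := hr.eq_of_level_eq hr' heq
      exact hne (S.label_unique hq' hq)
    · exact not_near_of_level_lt hlt (S.level_le_ladder_height hq' hq hlt) hr' hr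

/-- The topology in which the sets `{r | S.Near p m r}` form a neighbourhood basis of `p`. -/
instance : TopologicalSpace S.Point where
  IsOpen U := ∀ p ∈ U, ∃ m, ∀ r, S.Near p m r → r ∈ U
  isOpen_univ _ _ := ⟨0, fun _ _ => mem_univ _⟩
  isOpen_inter U V hU hV p hp := by
    obtain ⟨m, hm⟩ := hU p hp.1
    obtain ⟨m', hm'⟩ := hV p hp.2
    exact ⟨max m m', fun r hr =>
      ⟨hm r (hr.mono (le_max_left _ _)), hm' r (hr.mono (le_max_right _ _))⟩⟩
  isOpen_sUnion s hs p hp := by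
    obtain ⟨U, hU, hpU⟩ := hp
    obtain ⟨m, hm⟩ := hs U hU p hpU
    exact ⟨m, fun r hr => ⟨U, hU, hm r hr⟩⟩

theorem isOpen_iff {U : Set S.Point} :
    IsOpen U ↔ ∀ p ∈ U, ∃ m, ∀ r, S.Near p m r → r ∈ U := Iff.rfl

theorem isOpen_near (p : S.Point) (m : ℕ) : IsOpen {r | S.Near p m r} :=
  isOpen_iff.2 fun _ hq => hq.exists_subset

theorem hasBasis_nhds (p : S.Point) :
    (𝓝 p).HasBasis (fun _ : ℕ => True) fun m => {r | S.Near p m r} := by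
  refine ⟨fun U => ⟨fun hU => ?_, fun ⟨m, _, hm⟩ => ?_⟩⟩
  · obtain ⟨V, hVU, hV, hpV⟩ := mem_nhds_iff.1 hU
    obtain ⟨m, hm⟩ := isOpen_iff.1 hV p hpV
    exact ⟨m, trivial, fun r hr => hVU (hm r hr)⟩
  · exact mem_of_superset ((isOpen_near p m).mem_nhds (.refl p m)) hm

theorem isOpen_level_lt (γ : W) : IsOpen {p : S.Point | S.level p < γ} :=
  isOpen_iff.2 fun _ hp => ⟨0, fun _ hr => hr.level_le.trans_lt hp⟩

theorem isOpen_lt_level (γ : W) : IsOpen {p : S.Point | γ < S.level p} := by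
  refine isOpen_iff.2 fun p hp => ?_
  obtain ⟨m, hm⟩ := S.ladder_cofinal hp
  refine ⟨m, fun r hr => ?_⟩
  rcases hr.level_bounds with rfl | ⟨h, -⟩
  exacts [hp, hm.trans_lt h]

theorem eventually_level_le (p : S.Point) : ∀ᶠ r in 𝓝 p, S.level r ≤ S.level p :=
  (hasBasis_nhds p).eventually_iff.2 ⟨0, trivial, fun _ hr => hr.level_le⟩

instance : T2Space S.Point := by
  refine (t2Space_iff _).2 fun p p' hne => ?_
  have key : ∀ {p p' : S.Point}, S.level p < S.level p' →
      ∃ U V : Set S.Point, IsOpen U ∧ IsOpen V ∧ p ∈ U ∧ p' ∈ V ∧ Disjoint U V := by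
    intro p p' hlt
    obtain ⟨m, hm⟩ := S.ladder_cofinal hlt
    exact ⟨_, _, isOpen_near p 0, isOpen_near p' m, .refl _ _, .refl _ _,
      disjoint_left.2 fun r hr => not_near_of_level_lt hlt hm hr⟩
  rcases lt_trichotomy (S.level p) (S.level p') with hlt | heq | hlt
  · exact key hlt
  · exact ⟨_, _, isOpen_near p 0, isOpen_near p' 0, .refl _ _, .refl _ _,
      disjoint_left.2 fun r hr hr' => hne (hr.eq_of_level_eq hr' heq)⟩
  · obtain ⟨U, V, hU, hV, hpU, hpV, hd⟩ := key hlt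
    exact ⟨V, U, hV, hU, hpV, hpU, hd.symm⟩

/-- Basic neighbourhoods are compact: all but finitely many stages lie in any given smaller
neighbourhood of `p`, and the others contribute finitely many neighbourhoods of points of smaller
level. -/
theorem isCompact_near [WellFoundedLT W] (p : S.Point) (m : ℕ) :
    IsCompact {r | S.Near p m r} := by
  induction hδ : S.level p using WellFoundedLT.induction generalizing p m with
  | ind δ ih =>
  subst hδ
  refine isCompact_iff_ultrafilter_le_nhds.2 fun f hf => ?_
  by_cases hp : (f : Filter S.Point) ≤ 𝓝 p
  · exact ⟨p, .refl p m, hp⟩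
  obtain ⟨m₀, hm₀⟩ : ∃ m₀, {r | S.Near p m₀ r} ∉ f := by
    by_contra! hcon
    exact hp ((hasBasis_nhds p).ge_iff.2 fun m₀ _ => hcon m₀)
  have hK : IsCompact (⋃ n ∈ Ico m m₀, ⋃ q ∈ {z ∈ S.stage (S.level p) n | z.2 = S.index p},
      {r | S.Near q.1 (S.height (S.level p) n) r}) := by
    refine (finite_Ico m m₀).isCompact_biUnion fun n _ => ?_
    refine ((S.stage_finite _ n).subset (sep_subset _ _)).isCompact_biUnion fun z hz => ?_
    exact ih _ (S.level_lt hz.1) _ _ rfl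
  obtain ⟨x, hx, hfx⟩ := isCompact_iff_ultrafilter_le_nhds.1 hK f (by
    refine le_principal_iff.2 ?_
    filter_upwards [le_principal_iff.1 hf, Ultrafilter.compl_mem_iff_notMem.2 hm₀] with r hr hr₀
    cases hr with
    | refl => exact absurd (Near.refl p m₀) hr₀
    | @step _ _ n q _ hn hq hr =>
      have hlt : n < m₀ := lt_of_not_ge fun hle => hr₀ (Near.step hle hq hr)
      simp only [mem_iUnion]
      exact ⟨n, ⟨hn, hlt⟩, (q, S.index p), ⟨hq, rfl⟩, hr⟩)
  simp only [mem_iUnion] at hx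
  obtain ⟨n, hn, z, hz, hr⟩ := hx
  refine ⟨x, Near.step hn.1 (?_ : (z.1, S.index p) ∈ _) hr, hfx⟩
  rw [← hz.2]
  exact hz.1

instance [WellFoundedLT W] : LocallyCompactSpace S.Point :=
  .of_hasBasis hasBasis_nhds fun p m _ => isCompact_near p m

/-- Points of the stages at level `δ` with the label of `p` converge to `p`. -/
theorem tendsto_of_mem_stage {p : S.Point} {x : ℕ → S.Point}
    (hx : ∀ n, (x n, S.index p) ∈ S.stage (S.level p) n) : Tendsto x atTop (𝓝 p) := by
  refine (hasBasis_nhds p).tendsto_right_iff.2 fun m _ => ?_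
  filter_upwards [eventually_ge_atTop m] with n hn
  exact .step hn (hx n) (.refl _ _)

/-- Points of the stages at level `δ` whose label is not taken by a point of level `δ` converge to
infinity. -/
theorem tendsto_cocompact_of_mem_stage {δ : W} {x : ℕ → S.Point} {i : ℕ}
    (hx : ∀ n, (x n, i) ∈ S.stage δ n) (hi : ∀ p, S.level p = δ → S.index p ≠ i) :
    Tendsto x atTop (cocompact S.Point) := by
  refine (hasBasis_cocompact.tendsto_right_iff).2 fun K hK => ?_
  refine hK.induction_on (p := fun K => ∀ᶠ n in atTop, x n ∈ Kᶜ) ?_ ?_ ?_ ?_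
  · simp
  · exact fun s t hst ht => ht.mono fun n hn hs => hn (hst hs)
  · intro s t hs ht
    filter_upwards [hs, ht] with n h1 h2 h
    exact h.elim h1 h2
  · intro p _
    rcases lt_trichotomy (S.level p) δ with hlt | heq | hlt
    · refine ⟨_, mem_nhdsWithin_of_mem_nhds (eventually_level_le p), ?_⟩
      filter_upwards [S.eventually_le_ladder hlt] with n hn h
      exact (hn.trans_lt (S.ladder_lt (hx n))).not_ge h
    · refine ⟨_, mem_nhdsWithin_of_mem_nhds ((isOpen_near p 0).mem_nhds (.refl p 0)), ?_⟩
      exact .of_forall fun n => not_near_of_index_ne (hx n) heq (hi p heq)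
    · refine ⟨_, mem_nhdsWithin_of_mem_nhds ((isOpen_lt_level δ).mem_nhds hlt), ?_⟩
      exact .of_forall fun n h => lt_asymm h (S.level_lt (hx n))

end LadderSystem

/-! ### The space of guessed sequences -/

/-- A guess `(Q, k, R)` consists of a finite set `Q` of labelled points, where `((δ, i), j)` stands for
the point of level `δ` and index `i` labelled by `j`, of a bound `k` for the labels of points that
are meant to converge in the space, and of a strict bound `R` for the ranks of the points. -/
abbrev Guess (W : Type u) : Type u := Finset ((W × ℕ) × ℕ) × ℕ × ℕ

/-- The set of levels occupied by a guess. -/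
def Guess.levels {W : Type u} (t : Guess W) : Set W := {y | ∃ z ∈ t.1, z.1.1 = y}

theorem Guess.finite_levels {W : Type u} (t : Guess W) : t.levels.Finite :=
  t.1.finite_toSet.image fun z : (W × ℕ) × ℕ => z.1.1

/-- The sequence guessed at `δ` can be used for the definition of the topology at level `δ`: its terms
have unique labels, lie between the rungs of a ladder leading to `δ`, and consist of points whose
nominal rank is less than that of level `δ`. The nominal rank of a level is read off from the
first guess at that level, whether or not this guess is used, which avoids a recursion. -/
structure IsAdmissible {W : Type u} [LinearOrder W] (s : W → ℕ → Guess W) (b : W → ℕ → W)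
    (δ : W) : Prop where
  strictMono : StrictMono (b δ)
  ladder_lt : ∀ n, b δ n < δ
  cofinal : ∀ γ < δ, ∃ n, γ < b δ n
  between : ∀ n, ∀ z ∈ (s δ n).1, b δ n < z.1.1 ∧ z.1.1 < b δ (n + 1)
  rank_lt : ∀ n, ∀ z ∈ (s δ n).1, (s z.1.1 0).2.2 < (s δ 0).2.2
  label_unique : ∀ n q i j, (q, i) ∈ (s δ n).1 → (q, j) ∈ (s δ n).1 → i = j

open Classical in
/-- The ladder system that uses all admissible guesses. Level `δ` has the points of index at
most `k`, where `k` is read off from the first guess at `δ`; so every level is nonempty. Levels without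
an admissible guess have empty stages, and the constant `δ` in place of a ladder. -/
noncomputable def guessSystem {W : Type u} [LinearOrder W] (s : W → ℕ → Guess W)
    (b : W → ℕ → W) : LadderSystem W where
  Point := {p : W × ℕ // p.2 ≤ (s p.1 0).2.1}
  level p := p.1.1
  index p := p.1.2
  ext_point h h' := Subtype.ext (Prod.ext h h')
  stage δ n := {z | IsAdmissible s b δ ∧ (z.1.1, z.2) ∈ (s δ n).1}
  ladder δ n := if IsAdmissible s b δ then b δ n else δ
  stage_finite δ n := by
    refine (((s δ n).1.finite_toSet).preimage
      (f := fun z : {p : W × ℕ // p.2 ≤ (s p.1 0).2.1} × ℕ => (z.1.1, z.2)) ?_).subset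
      fun z hz => hz.2
    rintro ⟨p, i⟩ - ⟨q, j⟩ - h
    simp only [Prod.mk.injEq] at h
    exact Prod.ext (Subtype.ext h.1) h.2
  label_unique h h' := h.1.label_unique _ _ _ _ h.2 h'.2
  ladder_mono δ := by
    by_cases h : IsAdmissible s b δ
    · simpa only [h, if_true] using h.strictMono.monotone
    · simpa only [h, if_false] using monotone_const
  ladder_lt {δ n q i} h := by
    rw [if_pos h.1]
    exact (h.1.between _ _ h.2).1
  le_ladder {δ n q i} h := by
    rw [if_pos h.1]
    exact (h.1.between _ _ h.2).2.le
  level_lt h := (h.1.between _ _ h.2).2.trans (h.1.ladder_lt _)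
  ladder_cofinal {δ γ} hγ := by
    by_cases h : IsAdmissible s b δ
    · obtain ⟨n, hn⟩ := h.cofinal γ hγ
      exact ⟨n, by simpa only [h, if_true] using hn.le⟩
    · exact ⟨0, by simpa only [h, if_false] using hγ.le⟩

namespace LadderSystem

variable {W : Type u} [LinearOrder W] {s : W → ℕ → Guess W} {b : W → ℕ → W}

theorem guessSystem_rank_lt_of_near {p r : (guessSystem s b).Point} {m : ℕ}
    (h : (guessSystem s b).Near p m r) :
    r = p ∨ (s r.1.1 0).2.2 < (s p.1.1 0).2.2 := by
  induction h with
  | refl => exact .inl rfl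
  | step hn hq _ ih =>
    have hlt := hq.1.rank_lt _ _ hq.2
    rcases ih with rfl | ih
    exacts [.inr hlt, .inr (ih.trans hlt)]

theorem countable_level_le (hW : ∀ γ : W, (Iic γ).Countable) (γ : W) :
    {p : (guessSystem s b).Point | p.1.1 ≤ γ}.Countable := by
  have h : (Iic γ ×ˢ (univ : Set ℕ)).Countable := (hW γ).prod countable_univ
  have h' : {p : (guessSystem s b).Point | p.1.1 ≤ γ} ⊆ Subtype.val ⁻¹' (Iic γ ×ˢ univ) :=
    fun p hp => ⟨hp, mem_univ _⟩
  exact (h.preimage Subtype.val_injective).mono h'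

/-- The property of the guesses that `♣` provides: any uncountable family of guesses only countably
many of which reach below any given level contains one of the guessed sequences, and the ladder
separates the levels of its terms. -/
def IsGuessing {W : Type u} [LinearOrder W] (s : W → ℕ → Guess W) (b : W → ℕ → W) : Prop :=
  ∀ A : Set (Guess W), ¬ A.Countable → (∀ γ, {t ∈ A | ∃ y ∈ t.levels, y ≤ γ}.Countable) → ∃ α,
    StrictMono (b α) ∧ (∀ n, b α n < α) ∧ (∀ γ < α, ∃ n, γ < b α n) ∧
    ∀ n, s α n ∈ A ∧ ∀ y ∈ (s α n).levels, b α n < y ∧ y < b α (n + 1)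

/-- The heart of the collapsing property. Let `C` be an uncountable family of `m`-tuples with
pairwise disjoint sets of entries, and let the set of positions be coloured such that
different colours have different entries. Then a sequence in `C`, seen from some level `α`,
converges to different points of level `α` in the positions of colours less than `k`, and to infinity
in the other positions. -/
theorem exists_converging_sequence (hW : ∀ γ : W, (Iic γ).Countable) (hs : IsGuessing s b)
    {m : ℕ} (k : ℕ) (c : Fin m → ℕ) {C : Set (Fin m → (guessSystem s b).Point)}
    (hC : ¬ C.Countable) (hc : ∀ x ∈ C, ∀ i i', x i = x i' → c i = c i')
    (hdisj : ∀ x ∈ C, ∀ y ∈ C, ∀ i i', x i = y i' → x = y) :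
    ∃ (α : W) (x : ℕ → Fin m → (guessSystem s b).Point) (a : ℕ → (guessSystem s b).Point),
      (∀ n, x n ∈ C) ∧ (∀ n i, (x n i).1.1 < α) ∧ InjOn a (Iio k) ∧
      (∀ j < k, (a j).1.1 = α) ∧
      (∀ i, c i < k → Tendsto (fun n => x n i) atTop (𝓝 (a (c i)))) ∧
      ∀ i, k ≤ c i → Tendsto (fun n => x n i) atTop (cocompact (guessSystem s b).Point) := by
  -- Pass to an uncountable subfamily with a common bound for the ranks.
  obtain ⟨N, hN⟩ : ∃ N, ¬ {x ∈ C | ∀ i, (s (x i).1.1 0).2.2 < N}.Countable := by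
    by_contra! hcon
    have hcov : (⋃ N : ℕ, {x ∈ C | ∀ i, (s (x i).1.1 0).2.2 < N}).Countable :=
      countable_iUnion hcon
    refine hC (hcov.mono fun x hx => ?_)
    refine mem_iUnion.2 ⟨Finset.univ.sup (fun i => (s (x i).1.1 0).2.2) + 1, hx, fun i => ?_⟩
    exact Nat.lt_succ_of_le (Finset.le_sup (f := fun i => (s (x i).1.1 0).2.2) (Finset.mem_univ i))
  let t : (Fin m → (guessSystem s b).Point) → Guess W :=
    fun x => (Finset.univ.image fun i => ((x i).1, c i + 1), k, N)
  have ht : ∀ x z, z ∈ (t x).1 ↔ ∃ i, ((x i).1, c i + 1) = z := by simp [t]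
  have hm : Nonempty (Fin m) := by
    by_contra h
    rw [not_nonempty_iff] at h
    exact hC (subsingleton_of_subsingleton (s := C)).countable
  have htinj : InjOn t C := by
    intro x hx y hy hxy
    obtain ⟨i⟩ := hm
    obtain ⟨i', hi'⟩ := (ht y _).1 (hxy ▸ (ht x _).2 ⟨i, rfl⟩)
    exact hdisj x hx y hy i i' (Subtype.ext (Prod.ext_iff.1 hi').1.symm)
  obtain ⟨α, hmono, hlt, hcof, hα⟩ := hs (t '' {x ∈ C | ∀ i, (s (x i).1.1 0).2.2 < N})
    (fun h => hN (countable_of_injective_of_countable_image (htinj.mono (sep_subset _ _)) h)) (by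
      intro γ
      have hcount : (⋃ p ∈ {p : (guessSystem s b).Point | p.1.1 ≤ γ}, ⋃ i : Fin m,
          {x ∈ C | x i = p}).Countable := by
        refine (countable_level_le hW γ).biUnion fun p _ => countable_iUnion fun i =>
          Subsingleton.countable ?_
        exact fun x hx y hy => hdisj x hx.1 y hy.1 i i (hx.2.trans hy.2.symm)
      refine (hcount.image t).mono ?_
      rintro _ ⟨⟨x, hx, rfl⟩, y, ⟨z, hz, rfl⟩, hy⟩
      obtain ⟨i, rfl⟩ := (ht x z).1 hz
      refine ⟨x, ?_, rfl⟩
      simp only [mem_iUnion]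
      exact ⟨x i, hy, i, hx.1, rfl⟩)
  choose x hx hxs using fun n => (hα n).1
  have hadm : IsAdmissible s b α := by
    refine ⟨hmono, hlt, hcof, fun n z hz => (hα n).2 _ ⟨z, hz, rfl⟩, fun n z hz => ?_,
      fun n q i j hi hj => ?_⟩
    · rw [← hxs n] at hz
      obtain ⟨i, rfl⟩ := (ht _ z).1 hz
      rw [← hxs 0]
      exact (hx n).2 i
    · rw [← hxs n] at hi hj
      obtain ⟨i₁, h₁⟩ := (ht _ _).1 hi
      obtain ⟨i₂, h₂⟩ := (ht _ _).1 hj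
      rw [Prod.mk.injEq] at h₁ h₂
      rw [← h₁.2, ← h₂.2, hc _ (hx n).1 i₁ i₂ (Subtype.ext (h₁.1.trans h₂.1.symm))]
  have hk : (s α 0).2.1 = k := by rw [← hxs 0]
  have hstage : ∀ n i, (x n i, c i + 1) ∈ (guessSystem s b).stage α n := fun n i =>
    ⟨hadm, by rw [← hxs n]; exact (ht _ _).2 ⟨i, rfl⟩⟩
  -- The points of level `α` and index `j + 1 ≤ k`; the value for `j ≥ k` is irrelevant.
  let a : ℕ → (guessSystem s b).Point := fun j => ⟨(α, min (j + 1) k), by simp [hk]⟩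
  have haidx : ∀ j < k, (guessSystem s b).index (a j) = j + 1 := fun j hj =>
    min_eq_left (Nat.succ_le_of_lt hj)
  refine ⟨α, x, a, fun n => (hx n).1, fun n i => (guessSystem s b).level_lt (hstage n i), ?_,
    fun j hj => rfl, fun i hi => ?_, fun i hi => ?_⟩
  · intro j hj j' hj' h
    have := congrArg (guessSystem s b).index h
    rw [haidx j hj, haidx j' hj'] at this
    omega
  · refine tendsto_of_mem_stage fun n => ?_
    rw [haidx _ hi]
    exact hstage n i
  · refine tendsto_cocompact_of_mem_stage (fun n => hstage n i) fun p hp hidx => ?_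
    have h1 : p.1.2 ≤ (s p.1.1 0).2.1 := p.2
    have h2 : p.1.1 = α := hp
    have h3 : p.1.2 = c i + 1 := hidx
    rw [h2, hk] at h1
    omega

theorem hasCollapsingProperty_guessSystem (hW : ∀ γ : W, (Iic γ).Countable)
    (hs : IsGuessing s b) : HasCollapsingProperty (guessSystem s b).Point := by
  rintro m k I - hI C hC ⟨-, hsep⟩
  have hblk : ∀ i, ∃ j, i ∈ I j := fun i => mem_iUnion.1 (hI.cover ▸ mem_univ i)
  choose c hc using hblk
  have hceq : ∀ {i j}, i ∈ I j → c i = j := by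
    intro i j hij
    by_contra hne
    exact disjoint_left.1 (hI.disjoint _ _ hne) (hc i) hij
  have hdisj : ∀ x ∈ C, ∀ y ∈ C, ∀ i i', x i = y i' → c i = c i' ∧ x = y := by
    intro x hx y hy i i' h
    by_contra hcon
    have h' : c i ≠ c i' ∨ (⟨x, hx⟩ : C) ≠ ⟨y, hy⟩ := by
      rw [not_and_or] at hcon
      exact hcon.imp_right fun h hxy => h (congrArg Subtype.val hxy)
    exact disjoint_left.1 (hsep ⟨x, hx⟩ ⟨y, hy⟩ _ _ h') ⟨i, hc i, rfl⟩ ⟨i', hc i', h.symm⟩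
  obtain ⟨α, x, a, hxC, -, hainj, -, hconv, hinf⟩ :=
    exists_converging_sequence hW hs k (fun i => c i) hC
      (fun x hx i i' h => congrArg Fin.val (hdisj x hx x hx i i' h).1)
      (fun x hx y hy i i' h => (hdisj x hx y hy i i' h).2)
  let a' : Fin (k + 1) → OnePoint (guessSystem s b).Point :=
    fun j => if (j : ℕ) < k then (a j : OnePoint _) else ∞
  have ha'last : a' (Fin.last k) = ∞ := if_neg (by simp)
  have hlim : Tendsto (fun n i => (x n i : OnePoint (guessSystem s b).Point)) atTop
      (𝓝 fun i => a' (c i)) := by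
    refine tendsto_pi_nhds.2 fun i => ?_
    by_cases hi : (c i : ℕ) < k
    · simp only [a', hi, if_true]
      exact (OnePoint.continuous_coe.tendsto _).comp (hconv i hi)
    · simp only [a', hi, if_false]
      have := hinf i (not_lt.1 hi)
      rw [← coclosedCompact_eq_cocompact] at this
      exact OnePoint.tendsto_coe_infty.comp this
  obtain ⟨i₀, hi₀⟩ := hI.nonempty (Fin.last k)
  refine ⟨fun i => a' (c i), ?_, a', ?_, ha'last, fun j => ?_⟩
  · refine accPt_iff_frequently.2 (hlim.frequently (Frequently.of_forall fun n => ⟨fun h => ?_,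
      mem_image_of_mem _ (hxC n)⟩))
    have := congrFun h i₀
    simp only [hceq hi₀, ha'last] at this
    exact OnePoint.coe_ne_infty _ this
  · intro j j' h
    by_cases hj : (j : ℕ) < k <;> by_cases hj' : (j' : ℕ) < k <;>
      simp only [a', hj, hj', if_true, if_false] at h
    · exact Fin.ext (hainj hj hj' (OnePoint.coe_injective h))
    · exact absurd h (OnePoint.coe_ne_infty _)
    · exact absurd h.symm (OnePoint.coe_ne_infty _)
    · exact Fin.ext (by omega)
  · obtain ⟨i, hi⟩ := hI.nonempty j
    refine subset_antisymm ?_ (singleton_subset_iff.2 ⟨i, hi, by simp only [hceq hi]⟩)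
    rintro _ ⟨i', hi', rfl⟩
    simp only [hceq hi', mem_singleton_iff]

theorem not_countable_derivedSet (hW : ∀ γ : W, (Iic γ).Countable) (hs : IsGuessing s b)
    {Y : Set (guessSystem s b).Point} (hY : ¬ Y.Countable) : ¬ (derivedSet Y).Countable := by
  intro hD
  -- Discard the points whose level is at most that of some accumulation point of `Y`.
  have hlow : (⋃ p ∈ derivedSet Y, {q : (guessSystem s b).Point | q.1.1 ≤ p.1.1}).Countable :=
    hD.biUnion fun p _ => countable_level_le hW p.1.1
  set Y' := Y \ ⋃ p ∈ derivedSet Y, {q : (guessSystem s b).Point | q.1.1 ≤ p.1.1} with hY'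
  have hY'unc : ¬ Y'.Countable := fun h => hY ((h.union hlow).mono fun q hq => by
    by_cases hq' : q ∈ ⋃ p ∈ derivedSet Y, {q : (guessSystem s b).Point | q.1.1 ≤ p.1.1}
    exacts [.inr hq', .inl ⟨hq, hq'⟩])
  obtain ⟨α, x, a, hx, hlt, -, ha, hconv, -⟩ :=
    exists_converging_sequence hW hs (m := 1) 1 (fun _ => 0)
      (C := (fun y _ => y) '' Y')
      (fun h => hY'unc (countable_of_injective_of_countable_image
        (fun y _ y' _ h => congrFun h 0) h))
      (fun _ _ _ _ _ => rfl) (by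
        rintro _ ⟨y, -, rfl⟩ _ ⟨y', -, rfl⟩ i i' h
        exact funext fun _ => h)
  have hxY : ∀ n, x n 0 ∈ Y' := fun n => by
    obtain ⟨y, hy, h⟩ := hx n
    exact (congrFun h 0) ▸ hy
  have hlim := hconv 0 one_pos
  have hacc : a 0 ∈ derivedSet Y := by
    refine accPt_iff_frequently.2 (hlim.frequently (Frequently.of_forall fun n => ⟨fun h => ?_,
      (hxY n).1⟩))
    have := hlt n 0
    rw [h, ha 0 one_pos] at this
    exact this.false
  refine (hxY 0).2 (mem_biUnion hacc ?_)
  exact (ha 0 one_pos).symm ▸ (hlt 0 0).le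

/-- The derivatives of finite order are uncountable, since the derived set of an uncountable set
is. The derivative of order `n` only has points of nominal rank at least `n`, as nominal ranks decrease
along the stages. -/
theorem hasHeight_guessSystem (hW : ∀ γ : W, (Iic γ).Countable) (hs : IsGuessing s b)
    (hunc : Uncountable W) : HasHeight (guessSystem s b).Point ω := by
  have hne : ∀ n : ℕ, ¬ ((univ : Set (guessSystem s b).Point)ᵈ[(n : Ordinal.{u})]).Countable := by
    intro n
    induction n with
    | zero =>
      intro h
      have hcount : (univ : Set W).Countable := by
        simp only [Nat.cast_zero, CantorBendixson.iteratedDerivedSet_zero] at h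
        refine (h.image (guessSystem s b).level).mono fun w _ => ?_
        exact mem_image_of_mem _ (mem_univ (⟨(w, 0), Nat.zero_le _⟩ : (guessSystem s b).Point))
      exact not_countable_univ hcount
    | succ n ih =>
      rw [Nat.cast_succ, CantorBendixson.iteratedDerivedSet_succ,
        (CantorBendixson.isClosed_iteratedDerivedSet isClosed_univ _).relDerivedSet_eq]
      exact not_countable_derivedSet hW hs ih
  have hrank : ∀ n : ℕ, ∀ p ∈ (univ : Set (guessSystem s b).Point)ᵈ[(n : Ordinal.{u})],
      n ≤ (s p.1.1 0).2.2 := by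
    intro n
    induction n with
    | zero => exact fun _ _ => Nat.zero_le _
    | succ n ih =>
      intro p hp
      rw [Nat.cast_succ, CantorBendixson.iteratedDerivedSet_succ,
        (CantorBendixson.isClosed_iteratedDerivedSet isClosed_univ _).relDerivedSet_eq] at hp
      obtain ⟨q, ⟨hqp, hq⟩, hnear⟩ := ((accPt_iff_frequently.1 hp).and_eventually
        ((isOpen_near p 0).mem_nhds (.refl p 0))).exists
      rcases guessSystem_rank_lt_of_near hnear with h | h
      · exact absurd h hqp
      · exact (Nat.succ_le_succ (ih q hq)).trans h
  refine ⟨?_, fun σ hσ => ?_⟩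
  · rw [mem_ofPred_eq, eq_empty_iff_forall_notMem]
    intro p hp
    have hmem := CantorBendixson.iteratedDerivedSet_antitone univ
      (Ordinal.natCast_lt_omega0 ((s p.1.1 0).2.2 + 1)).le hp
    exact absurd (hrank _ p hmem) (by omega)
  · by_contra hlt
    obtain ⟨n, rfl⟩ := Ordinal.lt_omega0.1 (not_le.1 hlt)
    exact hne n (hσ ▸ countable_empty)

end LadderSystem

/-! ### The space `L` -/

theorem countable_Iio_omega_one_toType (γ : (ω₁ : Ordinal.{u}).ToType) : (Iio γ).Countable := by
  rw [← Cardinal.le_aleph0_iff_set_countable, ← Order.lt_succ_iff, Cardinal.succ_aleph0]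
  have h := Ordinal.card_typein (r := (· < · : (ω₁ : Ordinal.{u}).ToType → _ → Prop)) γ
  have h' := Cardinal.lt_omega_iff_card_lt.1 (Ordinal.typein_lt_self γ)
  exact lt_of_eq_of_lt h h'

theorem mk_guess (W : Type u) [Infinite W] : Cardinal.mk (Guess W) = Cardinal.mk W := by
  simp [Guess, Cardinal.mk_prod, Cardinal.mk_finset_of_infinite]

theorem theorem3p5 (hclub : Clubsuit.{u}) :
    ∃ (L : Type u) (_ : TopologicalSpace L),
      LocallyCompactSpace L ∧ T2Space L ∧ InClassS L ∧
        HasHeight L ω ∧ HasCollapsingProperty L := by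
  let W := (ω₁ : Ordinal.{u}).ToType
  have hIio : ∀ γ : W, (Iio γ).Countable := countable_Iio_omega_one_toType
  have hIic : ∀ γ : W, (Iic γ).Countable := fun γ => by
    rw [← Iio_insert]
    exact (hIio γ).insert γ
  have hunc : Uncountable W := by
    rw [← Cardinal.aleph0_lt_mk_iff, Cardinal.mk_toType, Ordinal.card_omega]
    exact Cardinal.aleph0_lt_aleph_one
  obtain ⟨x, hx⟩ := hclub.exists_sequences hIio
  obtain ⟨e⟩ : Nonempty (Guess W ↪ W) := Cardinal.le_def _ _ |>.1 (mk_guess W).le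
  obtain ⟨s, b, hs⟩ := exists_guessing hIic hx e.injective Guess.levels
    fun t => t.finite_levels.countable
  refine ⟨(guessSystem s b).Point, inferInstance, inferInstance, inferInstance,
    ⟨inferInstance, ?_⟩, LadderSystem.hasHeight_guessSystem hIic hs hunc,
    LadderSystem.hasCollapsingProperty_guessSystem hIic hs⟩
  let _ : TopologicalSpace W := Preorder.topology W
  have : OrderTopology W := ⟨rfl⟩
  have hcont : Continuous (guessSystem s b).level := OrderTopology.continuous_iff.2 fun γ =>
    ⟨LadderSystem.isOpen_lt_level γ, LadderSystem.isOpen_level_lt γ⟩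
  let f : W ≃ₜ Iio (ω₁ : Ordinal.{u}) := Ordinal.ToType.mk.symm.toHomeomorph
  refine ⟨fun p => f ((guessSystem s b).level p), f.continuous.comp hcont, fun α => ?_, fun α => ?_⟩
  · exact ⟨⟨(f.symm α, 0), Nat.zero_le _⟩, f.apply_symm_apply α⟩
  · refine Finite.subset (((finite_singleton (f.symm α)).prod
      (finite_Iic (s (f.symm α) 0).2.1)).preimage Subtype.val_injective.injOn) fun p hp => ?_
    have hp' : p.1.1 = f.symm α := f.injective ((hp : f _ = α).trans (f.apply_symm_apply α).symm)
    exact ⟨hp', hp' ▸ p.2⟩
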